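/- Let $\mathbb{D}=\{z=x+iy\in\mathbb{C}:|z|<1\}$, and write $\partial/\partial z=\tfrac12(\partial_x-i\partial_y)$, $\partial/\partial\bar z=\tfrac12(\partial_x+i\partial_y)$, $\Delta=\partial_x^2+\partial_y^2$. For integers $p,q\ge 1$ the scattering polynomial $\varphi^{(p,q)}:\mathbb{C}\to\mathbb{C}$ is defined by $$\varphi^{(p,q)}(z)=\frac{(-1)^p}{q\,(p+q-1)!}\,(1-z\bar z)\,\frac{\partial^{p+q}}{\partial z^p\,\partial\bar z^q}(1-z\bar z)^{p+q-1}.$$ Let $P^{(a,b)}_n(u)=\sum_{s=0}^n\binom{n+a}{n-s}\binom{n+b}{s}\left(\frac{u-1}{2}\right)^s\left(\frac{u+1}{2}\right)^{n-s}$ denote the Jacobi polynomials ($a,b,n$ nonnegative integers). Then the following hold. 1. Each $\varphi^{(p,q)}$ is a polynomial in $x$ and $y$ with complex coefficients. 2. The family $\{\varphi^{(p,q)}\}_{p,q\ge1}$ is an orthogonal basis of the Hilbert space $L^2\bigl(\mathbb{D},\frac{dx\,dy}{1-x^2-y^2}\bigr)$ of complex-valued functions: every $\varphi^{(p,q)}$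 belongs to this space and is nonzero in it, $\varphi^{(p,q)}$ and $\varphi^{(p',q')}$ are orthogonal whenever $(p,q)\ne(p',q')$, and the linear span of the family is dense. 3. Every even moment of the measure is infinite: $\int_{\mathbb{D}}x^{2m}y^{2n}\frac{dx\,dy}{1-x^2-y^2}=\infty$ for all integers $m,n\ge0$. 4. For all integers $p,q\ge1$ and all $z\in\mathbb{C}$, $-\frac{1-|z|^2}{4}\,\Delta\varphi^{(p,q)}(z)=pq\,\varphi^{(p,q)}(z)$. 5. For all integers $p,q\ge1$ and all real $r,\theta$, $$\varphi^{(p,q)}(re^{i\theta})=\frac{(-1)^{q+1}\max\{p,q\}}{q}\,(1-r^2)\,r^{|p-q|}\,P^{(1,|p-q|)}_{\min\{p,q\}-1}(2r^2-1)\,e^{i(q-p)\theta}.$$ -/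

import Mathlib

/-- The Wirtinger derivative `∂/∂z = (∂/∂x - i ∂/∂y) / 2`. -/
noncomputable def wirtingerZ (f : ℂ → ℂ) (z : ℂ) : ℂ :=
  (fderiv ℝ f z 1 - Complex.I * fderiv ℝ f z Complex.I) / 2

/-- The Wirtinger derivative `∂/∂z̄ = (∂/∂x + i ∂/∂y) / 2`. -/
noncomputable def wirtingerZBar (f : ℂ → ℂ) (z : ℂ) : ℂ :=
  (fderiv ℝ f z 1 + Complex.I * fderiv ℝ f z Complex.I) / 2

/-- The scattering polynomial `φ^{(p,q)}`, as a function on `ℂ`, given by its Rodrigues type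
formula (of interest for `p, q ≥ 1`). -/
noncomputable def scatteringPoly (p q : ℕ) (z : ℂ) : ℂ :=
  (-1) ^ p / ((q : ℂ) * ((p + q - 1).factorial : ℂ)) * (1 - z * star z) *
    (wirtingerZ^[p] (wirtingerZBar^[q] fun w : ℂ => (1 - w * star w) ^ (p + q - 1))) z

/-- The measure `dx dy / (1 - x² - y²)` on the open unit disk, as a measure on `ℂ` that vanishes
off the disk. -/
noncomputable def diskMeasure : MeasureTheory.Measure ℂ :=
  (MeasureTheory.volume.restrict (Metric.ball (0 : ℂ) 1)).withDensity
    fun z => ENNReal.ofReal (1 / (1 - z.re ^ 2 - z.im ^ 2))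

/-- The Jacobi polynomial `P_n^{(a,b)}` for nonnegative integers `a, b`, in the standard
normalization `P_n^{(a,b)}(1) = (n + a).choose n`. -/
noncomputable def jacobiP (a b n : ℕ) (x : ℝ) : ℝ :=
  ∑ s ∈ Finset.range (n + 1), ((n + a).choose (n - s) : ℝ) * ((n + b).choose s : ℝ) *
    ((x - 1) / 2) ^ s * ((x + 1) / 2) ^ (n - s)

/-- An orthogonal basis of a Hilbert space: nonzero, pairwise orthogonal vectors whose linear span
is dense. -/
structure IsOrthogonalBasis {ι H : Type*} [NormedAddCommGroup H] [InnerProductSpace ℂ H]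
    (v : ι → H) : Prop where
  ne_zero : ∀ i, v i ≠ 0
  orthogonal : ∀ i j, i ≠ j → inner ℂ (v i) (v j) = 0
  dense_span : (Submodule.span ℂ (Set.range v)).topologicalClosure = ⊤

open MeasureTheory

/-! Expanding the power of `1 - z * star z` by the binomial theorem and differentiating monomials
gives φ = (1 - |z|²) Σ c_k z^(k-p) z̄^(k-q), where c_k is `scatteringCoeff p q k` and only max p q ≤
k < p + q contributes. Polynomiality is then immediate. Since Δ = 4 ∂∂̄, the eigenvalue equation is
a relation between c_k and c_(k+1) (`scatteringCoeff_recurrence`). The polar form compares c_k with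
the coefficients of the Jacobi polynomial in powers of r² (`jacobiP_one_eq_sum`,
`scatteringCoeff_max_add`).

The factor 1 - |z|² of φ cancels the weight, so pairing with φ is Lebesgue integration over the disk
against the conjugate cofactor. The angular integral separates different values of p - q. For equal
values, pairing with (1 - |z|²) z^i z̄^j, i + 1 < q, gives an alternating binomial sum of a
polynomial in k of degree below p + q - 1, which is a vanishing finite difference
(`sum_scatteringCoeff_div_eq_zero`).

For density, the cofactors are triangular with respect to monomials. Hence a function orthogonal to
the family annihilates all monomials, by Stone-Weierstrass all continuous functions, and so is zero.
The moments diverge because 1 / (1 - r) is not integrable at r = 1. -/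

/-! ### Wirtinger derivatives of polynomials in z and z̄ -/

theorem hasFDerivAt_pow_mul_star_pow (a b : ℕ) (z : ℂ) :
    HasFDerivAt (𝕜 := ℝ) (fun w : ℂ => w ^ a * star w ^ b)
      ((a * z ^ (a - 1) * star z ^ b) • ContinuousLinearMap.id ℝ ℂ +
        (b * z ^ a * star z ^ (b - 1)) • Complex.conjCLE.toContinuousLinearMap) z := by
  have h1 : HasFDerivAt (𝕜 := ℝ) (fun w : ℂ => w ^ a) _ z := (hasFDerivAt_id z).pow a
  have h2 : HasFDerivAt (𝕜 := ℝ) (fun w : ℂ => star w ^ b) _ z :=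
    (Complex.conjCLE.toContinuousLinearMap.hasFDerivAt (x := z)).pow b
  refine (h1.mul h2).congr_fderiv ?_
  ext v
  simp
  ring

theorem hasFDerivAt_sum_pow_mul_star_pow (s : Finset ℕ) (c : ℕ → ℂ) (a b : ℕ → ℕ) (z : ℂ) :
    HasFDerivAt (𝕜 := ℝ) (fun w : ℂ => ∑ k ∈ s, c k * (w ^ a k * star w ^ b k))
      (∑ k ∈ s, c k • ((a k * z ^ (a k - 1) * star z ^ b k) • ContinuousLinearMap.id ℝ ℂ +
        (b k * z ^ a k * star z ^ (b k - 1)) • Complex.conjCLE.toContinuousLinearMap)) z := by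
  refine HasFDerivAt.fun_sum fun k _ => ?_
  exact (hasFDerivAt_pow_mul_star_pow (a k) (b k) z).const_mul (c k)

theorem contDiff_sum_pow_mul_star_pow (s : Finset ℕ) (c : ℕ → ℂ) (a b : ℕ → ℕ) :
    ContDiff ℝ 2 fun w : ℂ => ∑ k ∈ s, c k * (w ^ a k * star w ^ b k) := by
  refine ContDiff.sum fun k _ => contDiff_const.mul ((contDiff_id.pow _).mul ?_)
  exact Complex.conjCLE.contDiff.pow _

theorem wirtingerZ_sum (s : Finset ℕ) (c : ℕ → ℂ) (a b : ℕ → ℕ) :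
    wirtingerZ (fun w : ℂ => ∑ k ∈ s, c k * (w ^ a k * star w ^ b k)) =
      fun w => ∑ k ∈ s, c k * a k * (w ^ (a k - 1) * star w ^ b k) := by
  funext z
  rw [wirtingerZ, (hasFDerivAt_sum_pow_mul_star_pow s c a b z).fderiv]
  simp only [sum_apply, Finset.mul_sum, ← Finset.sum_sub_distrib,
    Finset.sum_div]
  refine Finset.sum_congr rfl fun k _ => ?_
  simp
  linear_combination (-(c k * (a k * z ^ (a k - 1) * (starRingEnd ℂ) z ^ b k -
    b k * z ^ a k * (starRingEnd ℂ) z ^ (b k - 1)) / 2)) * Complex.I_sq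

theorem wirtingerZBar_sum (s : Finset ℕ) (c : ℕ → ℂ) (a b : ℕ → ℕ) :
    wirtingerZBar (fun w : ℂ => ∑ k ∈ s, c k * (w ^ a k * star w ^ b k)) =
      fun w => ∑ k ∈ s, c k * b k * (w ^ a k * star w ^ (b k - 1)) := by
  funext z
  rw [wirtingerZBar, (hasFDerivAt_sum_pow_mul_star_pow s c a b z).fderiv]
  simp only [sum_apply, Finset.mul_sum, ← Finset.sum_add_distrib,
    Finset.sum_div]
  refine Finset.sum_congr rfl fun k _ => ?_
  simp
  linear_combination ((c k * (a k * z ^ (a k - 1) * (starRingEnd ℂ) z ^ b k -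
    b k * z ^ a k * (starRingEnd ℂ) z ^ (b k - 1)) / 2)) * Complex.I_sq

/-- The truncated exponent `a k - p` is harmless: `descFactorial` vanishes whenever `a k < p`. -/
theorem iterate_wirtingerZ_sum (p : ℕ) (s : Finset ℕ) (c : ℕ → ℂ) (a b : ℕ → ℕ) :
    wirtingerZ^[p] (fun w : ℂ => ∑ k ∈ s, c k * (w ^ a k * star w ^ b k)) =
      fun w => ∑ k ∈ s, c k * (a k).descFactorial p * (w ^ (a k - p) * star w ^ b k) := by
  induction p with
  | zero => simp
  | succ p ih =>
    rw [Function.iterate_succ_apply', ih, wirtingerZ_sum s (fun k => c k * (a k).descFactorial p)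
      (fun k => a k - p) b]
    funext w
    refine Finset.sum_congr rfl fun k _ => ?_
    rw [Nat.descFactorial_succ, Nat.sub_sub]
    push_cast
    ring

theorem iterate_wirtingerZBar_sum (q : ℕ) (s : Finset ℕ) (c : ℕ → ℂ) (a b : ℕ → ℕ) :
    wirtingerZBar^[q] (fun w : ℂ => ∑ k ∈ s, c k * (w ^ a k * star w ^ b k)) =
      fun w => ∑ k ∈ s, c k * (b k).descFactorial q * (w ^ a k * star w ^ (b k - q)) := by
  induction q with
  | zero => simp
  | succ q ih =>
    rw [Function.iterate_succ_apply', ih,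
      wirtingerZBar_sum s (fun k => c k * (b k).descFactorial q) a (fun k => b k - q)]
    funext w
    refine Finset.sum_congr rfl fun k _ => ?_
    rw [Nat.descFactorial_succ, Nat.sub_sub]
    push_cast
    ring

/-! ### Expansion of the scattering polynomials -/

/-- The coefficient of `z ^ (k - p) * z̄ ^ (k - q)` in `φ^{(p,q)} / (1 - z z̄)`. -/
noncomputable def scatteringCoeff (p q k : ℕ) : ℝ :=
  (-1) ^ p / (q * (p + q - 1).factorial) *
    ((-1) ^ k * (p + q - 1).choose k * k.descFactorial q * k.descFactorial p)

/-- The cofactor `φ^{(p,q)} / (1 - z z̄)`, in expanded form. -/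
noncomputable def scatteringCofactor (p q : ℕ) (z : ℂ) : ℂ :=
  ∑ k ∈ Finset.range (p + q), (scatteringCoeff p q k : ℂ) * (z ^ (k - p) * star z ^ (k - q))

theorem scatteringPoly_eq_mul_cofactor {p q : ℕ} (hq : 1 ≤ q) (z : ℂ) :
    scatteringPoly p q z = (1 - z * star z) * scatteringCofactor p q z := by
  have h : (fun w : ℂ => (1 - w * star w) ^ (p + q - 1)) = fun w =>
      ∑ k ∈ Finset.range (p + q), ((-1) ^ k * (p + q - 1).choose k : ℂ) *
        (w ^ k * star w ^ k) := by
    funext w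
    rw [sub_eq_neg_add, add_pow, Nat.sub_add_cancel (by omega : 1 ≤ p + q)]
    refine Finset.sum_congr rfl fun k _ => ?_
    rw [neg_pow, mul_pow, one_pow]
    ring
  rw [scatteringPoly, h, iterate_wirtingerZBar_sum q _ _ (fun k => k) (fun k => k),
    iterate_wirtingerZ_sum p _ _ (fun k => k) (fun k => k - q), scatteringCofactor,
    mul_comm _ (1 - z * star z), mul_assoc, Finset.mul_sum]
  congr 1
  refine Finset.sum_congr rfl fun k _ => ?_
  rw [scatteringCoeff]
  push_cast
  ring

theorem continuous_scatteringCofactor (p q : ℕ) : Continuous (scatteringCofactor p q) := by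
  unfold scatteringCofactor
  fun_prop

theorem scatteringCoeff_eq_zero {p q k : ℕ} (h : k < max p q) : scatteringCoeff p q k = 0 := by
  rcases lt_max_iff.1 h with h | h <;> simp [scatteringCoeff, Nat.descFactorial_of_lt h]

/-- The mixed second derivatives cancel by symmetry, which is where C² regularity enters. -/
theorem laplacian_eq_wirtinger {f : ℂ → ℂ} (hf : ContDiff ℝ 2 f) (z : ℂ) :
    Laplacian.laplacian f z = 4 * wirtingerZ (wirtingerZBar f) z := by
  have hd : DifferentiableAt ℝ (fderiv ℝ f) z :=
    (hf.fderiv_right (m := 1) (by norm_num)).differentiable (by norm_num) z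
  have happ (v : ℂ) : HasFDerivAt (fun w => fderiv ℝ f w v)
      ((fderiv ℝ (fderiv ℝ f) z).flip v) z := by
    simpa using hd.hasFDerivAt.clm_apply (hasFDerivAt_const v z)
  have hbar : HasFDerivAt (wirtingerZBar f) _ z :=
    ((happ 1).add ((happ Complex.I).const_mul Complex.I)).mul_const (2⁻¹ : ℂ)
  have hsymm : fderiv ℝ (fderiv ℝ f) z 1 Complex.I = fderiv ℝ (fderiv ℝ f) z Complex.I 1 :=
    (hf.contDiffAt (x := z)).isSymmSndFDerivAt (by simp) 1 Complex.I
  rw [InnerProductSpace.laplacian_eq_iteratedFDeriv_complexPlane, wirtingerZ, hbar.fderiv]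
  simp [iteratedFDeriv_two_apply, hsymm]
  linear_combination (fderiv ℝ (fderiv ℝ f) z Complex.I Complex.I) * Complex.I_sq

theorem exists_mvPolynomial_eq_scatteringPoly {p q : ℕ} (hq : 1 ≤ q) :
    ∃ P : MvPolynomial (Fin 2) ℂ, ∀ z : ℂ,
      scatteringPoly p q z = MvPolynomial.eval ![(z.re : ℂ), (z.im : ℂ)] P := by
  let Z : MvPolynomial (Fin 2) ℂ := .X 0 + .C Complex.I * .X 1
  let W : MvPolynomial (Fin 2) ℂ := .X 0 - .C Complex.I * .X 1
  refine ⟨(1 - Z * W) * ∑ k ∈ Finset.range (p + q),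
    .C (scatteringCoeff p q k : ℂ) * (Z ^ (k - p) * W ^ (k - q)), fun z => ?_⟩
  have hZ : MvPolynomial.eval ![(z.re : ℂ), (z.im : ℂ)] Z = z := by
    apply Complex.ext <;> simp [Z]
  have hW : MvPolynomial.eval ![(z.re : ℂ), (z.im : ℂ)] W = star z := by
    apply Complex.ext <;> simp [W]
  rw [scatteringPoly_eq_mul_cofactor hq, scatteringCofactor]
  simp only [map_mul, map_sub, map_one, map_sum, map_pow, hZ, hW, MvPolynomial.eval_C]

/-! ### The eigenvalue equation -/

theorem scatteringCoeff_succ {p q k : ℕ} (hk : k < p + q) :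
    scatteringCoeff p q (k + 1) * ((k + 1 - p : ℕ) * (k + 1 - q : ℕ)) =
      -((p + q - 1 - k : ℝ) * (k + 1)) * scatteringCoeff p q k := by
  have hp : ((k + 1 - p : ℕ) : ℝ) * (k + 1).descFactorial p = (k + 1) * k.descFactorial p :=
    mod_cast Nat.succ_descFactorial k p
  have hq : ((k + 1 - q : ℕ) : ℝ) * (k + 1).descFactorial q = (k + 1) * k.descFactorial q :=
    mod_cast Nat.succ_descFactorial k q
  have hc : ((p + q - 1).choose (k + 1) : ℝ) * (k + 1) =
      (p + q - 1).choose k * (p + q - 1 - k : ℝ) := by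
    have h := Nat.choose_succ_right_eq (p + q - 1) k
    have h' : ((p + q - 1 - k : ℕ) : ℝ) = p + q - 1 - k := by
      rw [Nat.cast_sub (by omega), Nat.cast_sub (by omega)]
      push_cast
      ring
    rw [← h']
    exact_mod_cast h
  unfold scatteringCoeff
  generalize (-1 : ℝ) ^ p / (q * (p + q - 1).factorial) = A
  calc _ = A * (-1) ^ (k + 1) * (p + q - 1).choose (k + 1) *
        (((k + 1 - p : ℕ) : ℝ) * (k + 1).descFactorial p) *
        (((k + 1 - q : ℕ) : ℝ) * (k + 1).descFactorial q) := by ring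
    _ = A * (-1) ^ (k + 1) * (((p + q - 1).choose (k + 1) : ℝ) * (k + 1)) *
        k.descFactorial p * ((k + 1) * k.descFactorial q) := by rw [hp, hq]; ring
    _ = _ := by rw [hc]; ring

/-- This compares coefficients of z^(k-p) z̄^(k-q) in ∂∂̄φ = -pq φ / (1 - |z|²). After eliminating
c_(k+1) it reduces to (p+q-1-k)(k+1) + (k-p+1)(k-q+1) = pq. -/
theorem scatteringCoeff_recurrence {p q k : ℕ} (hk : k < p + q) :
    scatteringCoeff p q (k + 1) * ((k + 1 - p : ℕ) * (k + 1 - q : ℕ)) -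
      scatteringCoeff p q k * ((k - p + 1 : ℕ) * (k - q + 1 : ℕ)) =
      -(p * q * scatteringCoeff p q k) := by
  rw [scatteringCoeff_succ hk]
  rcases lt_or_ge k (max p q) with h | h
  · simp [scatteringCoeff_eq_zero h]
  · rw [max_le_iff] at h
    push_cast [Nat.cast_sub h.1, Nat.cast_sub h.2]
    ring

theorem laplacian_sum_pow_mul_star_pow (s : Finset ℕ) (c : ℕ → ℂ) (a b : ℕ → ℕ) (z : ℂ) :
    Laplacian.laplacian (fun w : ℂ => ∑ k ∈ s, c k * (w ^ a k * star w ^ b k)) z =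
      4 * ∑ k ∈ s, c k * (a k * b k) * (z ^ (a k - 1) * star z ^ (b k - 1)) := by
  rw [laplacian_eq_wirtinger (contDiff_sum_pow_mul_star_pow s c a b), wirtingerZBar_sum,
    wirtingerZ_sum s (fun k => c k * b k) a (fun k => b k - 1)]
  congr 1
  refine Finset.sum_congr rfl fun k _ => ?_
  ring

theorem laplacian_scatteringPoly {p q : ℕ} (hq : 1 ≤ q) (z : ℂ) :
    Laplacian.laplacian (scatteringPoly p q) z =
      -(4 * (p * q * scatteringCofactor p q z)) := by
  have hφ : scatteringPoly p q =
      (fun w => ∑ k ∈ Finset.range (p + q),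
        (scatteringCoeff p q k : ℂ) * (w ^ (k - p) * star w ^ (k - q))) +
      fun w => ∑ k ∈ Finset.range (p + q),
        (-scatteringCoeff p q k : ℂ) * (w ^ (k - p + 1) * star w ^ (k - q + 1)) := by
    funext w
    rw [scatteringPoly_eq_mul_cofactor hq, scatteringCofactor, Pi.add_apply, sub_mul, one_mul,
      sub_eq_add_neg, Finset.mul_sum, ← Finset.sum_neg_distrib]
    congr 1
    refine Finset.sum_congr rfl fun k _ => ?_
    ring
  -- No boundary terms arise: at k = 0 the truncated factors `0 - p` and `0 - q` are zero, and at k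
  -- = p + q the binomial coefficient vanishes.
  have hshift : ∑ k ∈ Finset.range (p + q), (scatteringCoeff p q k : ℂ) *
      ((k - p : ℕ) * (k - q : ℕ)) * (z ^ (k - p - 1) * star z ^ (k - q - 1)) =
      ∑ k ∈ Finset.range (p + q), (scatteringCoeff p q (k + 1) : ℂ) *
      ((k + 1 - p : ℕ) * (k + 1 - q : ℕ)) * (z ^ (k - p) * star z ^ (k - q)) := by
    have hlast : scatteringCoeff p q (p + q) = 0 := by
      simp [scatteringCoeff, Nat.choose_eq_zero_of_lt (by omega : p + q - 1 < p + q)]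
    have h := Finset.sum_range_succ' (fun k => (scatteringCoeff p q k : ℂ) *
      ((k - p : ℕ) * (k - q : ℕ)) * (z ^ (k - p - 1) * star z ^ (k - q - 1))) (p + q)
    rw [Finset.sum_range_succ, hlast] at h
    simp only [Complex.ofReal_zero, zero_mul, add_zero, Nat.zero_sub, Nat.cast_zero,
      mul_zero] at h
    rw [h]
    refine Finset.sum_congr rfl fun k _ => ?_
    rw [(by omega : k + 1 - p - 1 = k - p), (by omega : k + 1 - q - 1 = k - q)]
  rw [hφ, (contDiff_sum_pow_mul_star_pow _ _ _ _).contDiffAt.laplacian_add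
      (contDiff_sum_pow_mul_star_pow _ _ _ _).contDiffAt,
    laplacian_sum_pow_mul_star_pow _ _ (fun k => k - p) (fun k => k - q), hshift,
    laplacian_sum_pow_mul_star_pow _ _ (fun k => k - p + 1) (fun k => k - q + 1),
    ← mul_add, ← Finset.sum_add_distrib, scatteringCofactor, ← mul_neg]
  congr 1
  rw [Finset.mul_sum, ← Finset.sum_neg_distrib]
  refine Finset.sum_congr rfl fun k hk => ?_
  have h : (scatteringCoeff p q (k + 1) : ℂ) * ((k + 1 - p : ℕ) * (k + 1 - q : ℕ)) -
      scatteringCoeff p q k * ((k - p + 1 : ℕ) * (k - q + 1 : ℕ)) =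
      -(p * q * scatteringCoeff p q k) :=
    mod_cast scatteringCoeff_recurrence (Finset.mem_range.1 hk)
  simp only [Nat.add_sub_cancel]
  linear_combination (z ^ (k - p) * star z ^ (k - q)) * h

theorem mul_star_eq_norm_sq (z : ℂ) : z * star z = (‖z‖ : ℂ) ^ 2 :=
  Complex.mul_conj' z

theorem neg_mul_laplacian_scatteringPoly {p q : ℕ} (hq : 1 ≤ q) (z : ℂ) :
    -((1 - (‖z‖ : ℂ) ^ 2) / 4 * Laplacian.laplacian (scatteringPoly p q) z) =
      p * q * scatteringPoly p q z := by
  rw [laplacian_scatteringPoly hq, scatteringPoly_eq_mul_cofactor hq, mul_star_eq_norm_sq]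
  ring

/-! ### Jacobi polynomials and the polar form -/

/-- Writing C(n+a, s) C(s, i) = C(n+a, i) C(n+a-i, s-i) pulls out a constant factor and leaves a
Vandermonde convolution. -/
theorem sum_choose_mul_choose_mul_choose (a n i : ℕ) (hi : i ≤ n) :
    ∑ s ∈ Finset.range (n + 1), (n + 1).choose (n - s) * (n + a).choose s * s.choose i =
      (n + a).choose i * (n + 1 + a + (n - i)).choose (n - i) := by
  obtain ⟨l, rfl⟩ := Nat.exists_eq_add_of_le hi
  rw [add_assoc i l 1, Finset.sum_range_add, Finset.sum_eq_zero, zero_add, Nat.add_sub_cancel_left,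
    (by ring : i + (l + 1) + a + l = (l + a) + (i + l + 1)), Nat.add_choose_eq (l + a),
    Finset.Nat.sum_antidiagonal_eq_sum_range_succ
      (fun u v => (l + a).choose u * (i + l + 1).choose v), Finset.mul_sum]
  · refine Finset.sum_congr rfl fun u hu => ?_
    have hu : u ≤ l := by simpa [Nat.lt_succ_iff] using hu
    rw [mul_assoc, Nat.choose_mul (Nat.le_add_right i u),
      (by omega : i + l + a - i = l + a), (by omega : i + u - i = u),
      (by omega : i + l - (i + u) = l - u), ← add_assoc]
    ring
  · intro s hs
    simp [Nat.choose_eq_zero_of_lt (Finset.mem_range.1 hs)]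

/-- With u = 2t - 1 the two bases in the definition are t - 1 and t. Expanding (t - 1)^s and
collecting powers of t leaves the preceding binomial sum as coefficient. -/
theorem jacobiP_one_eq_sum (a n : ℕ) (t : ℝ) :
    jacobiP 1 a n (2 * t - 1) = ∑ j ∈ Finset.range (n + 1),
      (-1) ^ (n - j) * ((n + a).choose (n - j) * (n + 1 + a + j).choose j : ℕ) * t ^ j := by
  have hexp : ∀ s ∈ Finset.range (n + 1), (t - 1) ^ s * t ^ (n - s) =
      ∑ i ∈ Finset.range (n + 1), (s.choose i : ℝ) * (-1) ^ i * t ^ (n - i) := by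
    intro s hs
    have hs : s ≤ n := by simpa [Nat.lt_succ_iff] using hs
    rw [sub_eq_neg_add, add_pow, Finset.sum_mul]
    refine (Finset.sum_congr rfl fun i hi => ?_).trans (Finset.sum_subset
      (Finset.range_mono (Nat.succ_le_succ hs)) fun i _ hi => ?_)
    · have hi : i ≤ s := by simpa [Nat.lt_succ_iff] using hi
      rw [(by omega : n - i = (s - i) + (n - s)), pow_add]
      ring
    · rw [Nat.choose_eq_zero_of_lt (by simpa using hi)]
      simp
  have hL : jacobiP 1 a n (2 * t - 1) = ∑ i ∈ Finset.range (n + 1),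
      (-1) ^ i * ((n + a).choose i * (n + 1 + a + (n - i)).choose (n - i) : ℕ) * t ^ (n - i) := by
    have h1 : jacobiP 1 a n (2 * t - 1) = ∑ s ∈ Finset.range (n + 1),
        ∑ i ∈ Finset.range (n + 1), ((n + 1).choose (n - s) * (n + a).choose s : ℝ) *
          ((s.choose i : ℝ) * (-1) ^ i * t ^ (n - i)) := by
      refine Finset.sum_congr rfl fun s hs => ?_
      rw [← Finset.mul_sum, ← hexp s hs]
      ring
    rw [h1, Finset.sum_comm]
    refine Finset.sum_congr rfl fun i hi => ?_
    rw [← sum_choose_mul_choose_mul_choose a n i (by simpa [Nat.lt_succ_iff] using hi)]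
    push_cast
    rw [Finset.mul_sum, Finset.sum_mul]
    refine Finset.sum_congr rfl fun s _ => ?_
    ring
  rw [hL, ← Finset.sum_flip]
  refine Finset.sum_congr rfl fun j hj => ?_
  rw [Nat.sub_sub_self (by simpa [Nat.lt_succ_iff] using hj)]

theorem choose_mul_descFactorial_mul_descFactorial (a n j : ℕ) (hj : j ≤ n) :
    (2 * n + a + 1).choose (n + a + 1 + j) * (n + a + 1 + j).descFactorial (n + 1) *
      (n + a + 1 + j).descFactorial (n + a + 1) =
    (2 * n + a + 1).factorial * (n + a + 1) *
      ((n + a).choose (n - j) * (n + 1 + a + j).choose j) := by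
  obtain ⟨m, rfl⟩ := Nat.exists_eq_add_of_le hj
  have h1 := Nat.choose_mul_factorial_mul_factorial
    (by omega : j + m + a + 1 + j ≤ 2 * (j + m) + a + 1)
  have h2 := Nat.factorial_mul_descFactorial (by omega : j + m + 1 ≤ j + m + a + 1 + j)
  have h3 := Nat.factorial_mul_descFactorial (by omega : j + m + a + 1 ≤ j + m + a + 1 + j)
  have h4 := Nat.choose_mul_factorial_mul_factorial (by omega : m ≤ j + m + a)
  have h5 := Nat.choose_mul_factorial_mul_factorial (by omega : j ≤ j + m + a + 1 + j)
  rw [(by omega : 2 * (j + m) + a + 1 - (j + m + a + 1 + j) = m)] at h1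
  rw [(by omega : j + m + a + 1 + j - (j + m + 1) = j + a)] at h2
  rw [(by omega : j + m + a + 1 + j - (j + m + a + 1) = j)] at h3
  rw [(by omega : j + m + a - m = j + a)] at h4
  rw [(by omega : j + m + a + 1 + j - j = (j + m + a) + 1), Nat.factorial_succ] at h5
  rw [(by omega : j + m - j = m), (by omega : j + m + 1 + a + j = j + m + a + 1 + j)]
  -- The product of all factorials needed to clear denominators, so that `h1` to `h5` apply without
  -- division.
  have hpos : 0 < (j + m + a + 1 + j).factorial * m.factorial * (j + a).factorial * j.factorial *
      (j + m + a).factorial := by positivity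
  refine Nat.eq_of_mul_eq_mul_right hpos ?_
  generalize (j + m + a + 1 + j).choose j = C5 at *
  generalize (j + m + a).choose m = C4 at *
  generalize (2 * (j + m) + a + 1).choose (j + m + a + 1 + j) = C1 at *
  generalize (j + m + a + 1 + j).descFactorial (j + m + 1) = D2 at *
  generalize (j + m + a + 1 + j).descFactorial (j + m + a + 1) = D3 at *
  generalize (j + m + a + 1 + j).factorial = K at *
  generalize (2 * (j + m) + a + 1).factorial = F at *
  generalize (j + m + a).factorial = G at *
  generalize (j + a).factorial = H at *
  generalize j.factorial = J at *
  generalize m.factorial = Q at *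
  calc C1 * D2 * D3 * (K * Q * H * J * G) = (C1 * K * Q) * (H * D2) * (J * D3) * G := by ring
    _ = F * K * K * G := by rw [h1, h2, h3]
    _ = F * K * (C5 * J * ((j + m + a + 1) * G)) * (C4 * Q * H) := by rw [h4, h5]
    _ = _ := by ring

theorem scatteringCoeff_max_add {p q n a j : ℕ} (hmax : max p q = n + a + 1)
    (hmin : min p q = n + 1) (hj : j ≤ n) :
    scatteringCoeff p q (n + a + 1 + j) = (-1) ^ (q + 1) * (n + a + 1 : ℕ) / q *
      ((-1) ^ (n - j) * ((n + a).choose (n - j) * (n + 1 + a + j).choose j : ℕ)) := by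
  have hN : p + q - 1 = 2 * n + a + 1 := by omega
  have hD (k : ℕ) : k.descFactorial q * k.descFactorial p =
      k.descFactorial (n + 1) * k.descFactorial (n + a + 1) := by
    rw [← hmax, ← hmin]
    rcases le_total p q with h | h
    · rw [max_eq_right h, min_eq_left h, mul_comm]
    · rw [max_eq_left h, min_eq_right h]
  -- Parity: p + q = 2n + a + 2.
  have hsign : (-1 : ℝ) ^ p * (-1) ^ (n + a + 1 + j) = (-1) ^ (q + 1) * (-1) ^ (n - j) := by
    rw [← pow_add, ← pow_add, neg_one_pow_eq_pow_mod_two,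
      neg_one_pow_eq_pow_mod_two (n := q + 1 + _)]
    congr 1
    omega
  have hkey : ((2 * n + a + 1).choose (n + a + 1 + j) *
      ((n + a + 1 + j).descFactorial q * (n + a + 1 + j).descFactorial p) : ℝ) =
      (2 * n + a + 1).factorial * (n + a + 1 : ℕ) *
      ((n + a).choose (n - j) * (n + 1 + a + j).choose j : ℕ) := by
    have h := choose_mul_descFactorial_mul_descFactorial a n j hj
    rw [mul_assoc, ← hD] at h
    exact_mod_cast h
  have hF : ((2 * n + a + 1).factorial : ℝ) ≠ 0 := by positivity
  rw [scatteringCoeff, hN]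
  calc _ = ((-1 : ℝ) ^ p * (-1) ^ (n + a + 1 + j)) / (q * (2 * n + a + 1).factorial) *
      ((2 * n + a + 1).choose (n + a + 1 + j) *
      ((n + a + 1 + j).descFactorial q * (n + a + 1 + j).descFactorial p) : ℝ) := by ring
    _ = _ := by
      rw [hsign, hkey, ← div_div]
      field_simp

/-- The cofactor in polar coordinates. -/
theorem scatteringCofactor_polar {p q : ℕ} (hp : 1 ≤ p) (hq : 1 ≤ q) (r θ : ℝ) :
    scatteringCofactor p q (r * Complex.exp (Complex.I * θ)) =
      (-1) ^ (q + 1) * (max p q : ℕ) / (q : ℂ) *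
        ((r ^ ((p : ℤ) - (q : ℤ)).natAbs *
          jacobiP 1 ((p : ℤ) - (q : ℤ)).natAbs (min p q - 1) (2 * r ^ 2 - 1) : ℝ) : ℂ) *
        Complex.exp (Complex.I * ((q : ℂ) - (p : ℂ)) * θ) := by
  obtain ⟨n, hn⟩ : ∃ n, min p q = n + 1 := Nat.exists_eq_succ_of_ne_zero (by omega)
  set a := ((p : ℤ) - (q : ℤ)).natAbs with ha
  have hmax : max p q = n + a + 1 := by omega
  -- Here n + a + 1 = max p q, so both subtractions are exact; the two exponents have sum a + 2j and
  -- difference q - p.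
  have hmono {j : ℕ} : ((r : ℂ) * Complex.exp (Complex.I * θ)) ^ (n + a + 1 + j - p) *
      star ((r : ℂ) * Complex.exp (Complex.I * θ)) ^ (n + a + 1 + j - q) =
      (r : ℂ) ^ a * ((r : ℂ) ^ 2) ^ j * Complex.exp (Complex.I * ((q : ℂ) - (p : ℂ)) * θ) := by
    have hst : star ((r : ℂ) * Complex.exp (Complex.I * θ)) =
        (r : ℂ) * Complex.exp (-(Complex.I * θ)) := by
      change (starRingEnd ℂ) _ = _
      rw [map_mul, Complex.conj_ofReal, ← Complex.exp_conj]
      simp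
    have hexp : Complex.exp (Complex.I * ((q : ℂ) - (p : ℂ)) * θ) =
        Complex.exp (Complex.I * θ) ^ (n + a + 1 + j - p) *
        Complex.exp (-(Complex.I * θ)) ^ (n + a + 1 + j - q) := by
      rw [← Complex.exp_nat_mul, ← Complex.exp_nat_mul, ← Complex.exp_add,
        Nat.cast_sub (by omega), Nat.cast_sub (by omega)]
      congr 1
      ring
    rw [hst, hexp, mul_pow, mul_pow, ← pow_mul, ← pow_add,
      (by omega : a + 2 * j = (n + a + 1 + j - p) + (n + a + 1 + j - q)), pow_add]
    ring
  rw [scatteringCofactor, (by omega : p + q = (n + a + 1) + (n + 1)), Finset.sum_range_add,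
    Finset.sum_eq_zero, zero_add, hn, Nat.add_sub_cancel, jacobiP_one_eq_sum, hmax]
  · push_cast
    rw [Finset.mul_sum, Finset.mul_sum, Finset.sum_mul]
    refine Finset.sum_congr rfl fun j hj => ?_
    rw [hmono, scatteringCoeff_max_add hmax hn (by simpa [Nat.lt_succ_iff] using hj)]
    push_cast
    ring
  · intro k hk
    rw [scatteringCoeff_eq_zero (by rw [hmax]; exact Finset.mem_range.1 hk)]
    simp

theorem scatteringPoly_polar {p q : ℕ} (hp : 1 ≤ p) (hq : 1 ≤ q) (r θ : ℝ) :
    scatteringPoly p q ((r : ℂ) * Complex.exp (Complex.I * θ)) =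
      (-1) ^ (q + 1) * (max p q : ℕ) / (q : ℂ) *
        (((1 - r ^ 2) * r ^ ((p : ℤ) - (q : ℤ)).natAbs *
          jacobiP 1 ((p : ℤ) - (q : ℤ)).natAbs (min p q - 1) (2 * r ^ 2 - 1) : ℝ) : ℂ) *
        Complex.exp (Complex.I * ((q : ℂ) - (p : ℂ)) * θ) := by
  rw [scatteringPoly_eq_mul_cofactor hq, scatteringCofactor_polar hp hq, mul_star_eq_norm_sq,
    norm_mul, mul_comm Complex.I, Complex.norm_exp_ofReal_mul_I, mul_one, ← Complex.ofReal_pow,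
    Complex.norm_real, Real.norm_eq_abs, sq_abs]
  push_cast
  ring

theorem jacobiP_at_one (a b n : ℕ) : jacobiP a b n 1 = (n + a).choose n := by
  rw [jacobiP, Finset.sum_range_succ', Finset.sum_eq_zero]
  · simp
  · intro s _
    simp

/-- The polar form at r = 1, θ = 0 reduces this to the nonzero value of the Jacobi polynomial at 1.
-/
theorem scatteringCofactor_one_ne_zero {p q : ℕ} (hp : 1 ≤ p) (hq : 1 ≤ q) :
    scatteringCofactor p q 1 ≠ 0 := by
  have h := scatteringCofactor_polar hp hq 1 0
  rw [Complex.ofReal_zero, mul_zero, mul_zero, Complex.exp_zero, Complex.ofReal_one, mul_one,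
    mul_one, one_pow, one_pow, (by norm_num : (2 * 1 - 1 : ℝ) = 1), jacobiP_at_one, one_mul] at h
  rw [h]
  have hmax : ((max p q : ℕ) : ℂ) ≠ 0 := Nat.cast_ne_zero.2 (by omega)
  have hq' : (q : ℂ) ≠ 0 := Nat.cast_ne_zero.2 (by omega)
  have hc : ((min p q - 1 + 1).choose (min p q - 1) : ℝ) ≠ 0 :=
    Nat.cast_ne_zero.2 (Nat.choose_pos (by omega)).ne'
  exact mul_ne_zero (div_ne_zero (mul_ne_zero (by simp) hmax) hq') (mod_cast hc)

/-! ### Vanishing finite differences -/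

/-- Up to the sign (-1)^n the sum is the n-th forward difference of `P` at 0. -/
theorem Polynomial.sum_neg_one_pow_mul_choose_mul_eval_eq_zero (P : Polynomial ℝ) {n : ℕ}
    (hP : P.natDegree < n) :
    ∑ k ∈ Finset.range (n + 1), (-1) ^ k * (n.choose k : ℝ) * P.eval (k : ℝ) = 0 := by
  have h := congrFun (Polynomial.fwdDiff_iter_eq_zero_of_degree_lt hP) 0
  rw [fwdDiff_iter_eq_sum_shift] at h
  simp only [zero_add, nsmul_eq_mul, mul_one, zsmul_eq_mul, Pi.zero_apply] at h
  rw [← mul_zero ((-1 : ℝ) ^ n), ← h, Finset.mul_sum]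
  refine Finset.sum_congr rfl fun k hk => ?_
  have hk : k ≤ n := by simpa [Nat.lt_succ_iff] using hk
  obtain ⟨m, rfl⟩ := Nat.exists_eq_add_of_le hk
  push_cast
  rw [Nat.add_sub_cancel_left, pow_add]
  have : ((-1 : ℝ) ^ m) * (-1) ^ m = 1 := by rw [← mul_pow]; simp
  linear_combination (-(-1) ^ k * ((k + m).choose k : ℝ) * P.eval (k : ℝ)) * this

theorem Nat.cast_descFactorial_eq_prod (k q : ℕ) :
    (k.descFactorial q : ℝ) = ∏ r ∈ Finset.range q, ((k : ℝ) - r) := by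
  rw [← descPochhammer_eval_eq_descFactorial, descPochhammer_eval_eq_prod_range]

/-- The denominators cancel two of the linear factors of `k.descFactorial q`, which leaves a
polynomial in k of degree at most p + q - 2 under an alternating binomial sum of order p + q - 1. -/
theorem sum_scatteringCoeff_div_eq_zero {p q u : ℕ} (hp : u + 1 < p) (hq : u + 1 < q) :
    ∑ k ∈ Finset.range (p + q),
      scatteringCoeff p q k / (((k : ℝ) - u) * ((k : ℝ) - (u + 1 : ℕ))) = 0 := by
  classical
  let s := ((Finset.range q).erase u).erase (u + 1)
  have hu : u ∈ Finset.range q := Finset.mem_range.2 (by omega)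
  have hu' : u + 1 ∈ (Finset.range q).erase u := by simp [hq]
  let Q : Polynomial ℝ := (∏ r ∈ Finset.range p, (.X - .C (r : ℝ))) * ∏ r ∈ s, (.X - .C (r : ℝ))
  have hdeg : Q.natDegree < p + q - 1 := by
    have h1 : Q.natDegree ≤ p + (q - 1 - 1) := by
      refine Polynomial.natDegree_mul_le.trans (add_le_add ?_ ?_) <;>
      refine (Polynomial.natDegree_prod_le _ _).trans ?_
      · simp only [Polynomial.natDegree_X_sub_C, Finset.sum_const, smul_eq_mul, mul_one,
          Finset.card_range, le_refl]
      · simp only [Polynomial.natDegree_X_sub_C, Finset.sum_const, smul_eq_mul, mul_one]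
        rw [Finset.card_erase_of_mem hu', Finset.card_erase_of_mem hu, Finset.card_range]
    omega
  have heval (k : ℕ) : (k.descFactorial q : ℝ) * k.descFactorial p /
      (((k : ℝ) - u) * ((k : ℝ) - (u + 1 : ℕ))) = Q.eval (k : ℝ) := by
    simp only [Q, Polynomial.eval_mul, Polynomial.eval_prod, Polynomial.eval_sub,
      Polynomial.eval_X, Polynomial.eval_C]
    -- At these two points the quotient is 0 by the convention on division by zero. The polynomial
    -- agrees because k < p makes its other product vanish.
    by_cases hk : k = u ∨ k = u + 1
    · have h0 : k < p := by omega
      rw [← Nat.cast_descFactorial_eq_prod, Nat.descFactorial_of_lt h0]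
      simp
    · have h1 : (k : ℝ) - u ≠ 0 := sub_ne_zero.2 (by norm_cast; tauto)
      have h2 : (k : ℝ) - (u + 1 : ℕ) ≠ 0 := sub_ne_zero.2 (by norm_cast; tauto)
      rw [Nat.cast_descFactorial_eq_prod k q, Nat.cast_descFactorial_eq_prod k p,
        ← Finset.mul_prod_erase _ _ hu, ← Finset.mul_prod_erase _ _ hu']
      field_simp
      exact mul_comm _ _
  have h := Q.sum_neg_one_pow_mul_choose_mul_eval_eq_zero hdeg
  rw [Nat.sub_add_cancel (by omega)] at h
  rw [← mul_zero ((-1 : ℝ) ^ p / (q * (p + q - 1).factorial)), ← h, Finset.mul_sum]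
  refine Finset.sum_congr rfl fun k _ => ?_
  rw [← heval, scatteringCoeff]
  ring

/-! ### Integrals over the disk in polar coordinates -/

theorem setIntegral_ball_eq_polar (f : ℂ → ℂ) :
    ∫ z in Metric.ball (0 : ℂ) 1, f z =
      ∫ x in Set.Ioo (0 : ℝ) 1 ×ˢ Set.Ioo (-Real.pi) Real.pi,
        (x.1 : ℂ) * f (x.1 * Complex.exp (Complex.I * x.2)) := by
  have hm : MeasurableSet (Set.Iio (1 : ℝ) ×ˢ (Set.univ : Set ℝ)) :=
    measurableSet_Iio.prod MeasurableSet.univ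
  have hset : Set.Ioo (0 : ℝ) 1 ×ˢ Set.Ioo (-Real.pi) Real.pi =
      polarCoord.target ∩ (Set.Iio (1 : ℝ) ×ˢ Set.univ) := by
    ext x
    simp [polarCoord]
    tauto
  rw [← integral_indicator measurableSet_ball, ← Complex.integral_comp_polarCoord_symm, hset,
    ← setIntegral_indicator hm]
  refine setIntegral_congr_fun polarCoord.open_target.measurableSet fun x hx => ?_
  have hx0 : 0 < x.1 := hx.1
  have hpol : Complex.polarCoord.symm x = x.1 * Complex.exp (Complex.I * x.2) := by
    rw [Complex.polarCoord_symm_apply, mul_comm Complex.I, Complex.exp_mul_I]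
    simp
  by_cases h : x.1 < 1
  · rw [Set.indicator_of_mem, Set.indicator_of_mem, hpol]
    · simp
    · simp [h]
    · rw [mem_ball_zero_iff, Complex.norm_polarCoord_symm, abs_of_pos hx0]
      exact h
  · rw [Set.indicator_of_notMem, Set.indicator_of_notMem, smul_zero]
    · simp [h]
    · rw [mem_ball_zero_iff, Complex.norm_polarCoord_symm, abs_of_pos hx0]
      exact h

theorem integral_exp_int_mul {n : ℤ} (hn : n ≠ 0) :
    ∫ θ in Set.Ioo (-Real.pi) Real.pi, Complex.exp (Complex.I * n * θ) = 0 := by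
  have hc : Complex.I * n ≠ 0 := by simp [hn]
  rw [← integral_Ioc_eq_integral_Ioo, ← intervalIntegral.integral_of_le (by linarith [Real.pi_pos]),
    integral_exp_mul_complex hc, div_eq_zero_iff, sub_eq_zero]
  left
  rw [Complex.exp_eq_exp_iff_exists_int]
  refine ⟨n, ?_⟩
  push_cast
  ring

theorem integral_pow_mul_one_sub_sq (m : ℕ) :
    ∫ r in Set.Ioo (0 : ℝ) 1, ((r ^ (2 * m + 1) * (1 - r ^ 2) : ℝ) : ℂ) =
      ((1 / (2 * ((m + 1) * (m + 2))) : ℝ) : ℂ) := by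
  rw [integral_complex_ofReal, ← integral_Ioc_eq_integral_Ioo,
    ← intervalIntegral.integral_of_le zero_le_one]
  congr 1
  have h : (fun r : ℝ => r ^ (2 * m + 1) * (1 - r ^ 2)) =
      fun r => r ^ (2 * m + 1) - r ^ (2 * m + 3) := by
    funext r
    ring
  rw [h, intervalIntegral.integral_sub (by simp) (by simp), integral_pow, integral_pow]
  push_cast
  simp
  field_simp
  ring

theorem setIntegral_ball_pow_mul_star_pow (i j : ℕ) :
    ∫ z in Metric.ball (0 : ℂ) 1, (1 - z * star z) * (z ^ i * star z ^ j) =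
      if i = j then ((Real.pi / ((i + 1) * (i + 2)) : ℝ) : ℂ) else 0 := by
  have hpolar (x : ℝ × ℝ) : (x.1 : ℂ) * ((1 - (x.1 * Complex.exp (Complex.I * x.2)) *
      star ((x.1 : ℂ) * Complex.exp (Complex.I * x.2))) *
      (((x.1 : ℂ) * Complex.exp (Complex.I * x.2)) ^ i *
        star ((x.1 : ℂ) * Complex.exp (Complex.I * x.2)) ^ j)) =
      ((x.1 ^ (i + j + 1) * (1 - x.1 ^ 2) : ℝ) : ℂ) *
        Complex.exp (Complex.I * ((i - j : ℤ) : ℂ) * x.2) := by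
    have hst : star ((x.1 : ℂ) * Complex.exp (Complex.I * x.2)) =
        (x.1 : ℂ) * Complex.exp (-(Complex.I * x.2)) := by
      change (starRingEnd ℂ) _ = _
      rw [map_mul, Complex.conj_ofReal, ← Complex.exp_conj]
      simp
    have hexp : Complex.exp (Complex.I * ((i - j : ℤ) : ℂ) * x.2) =
        Complex.exp (Complex.I * x.2) ^ i * Complex.exp (-(Complex.I * x.2)) ^ j := by
      rw [← Complex.exp_nat_mul, ← Complex.exp_nat_mul, ← Complex.exp_add]
      congr 1
      push_cast
      ring
    have hone : Complex.exp (Complex.I * x.2) * Complex.exp (-(Complex.I * x.2)) = 1 := by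
      rw [← Complex.exp_add]
      simp
    rw [hst, hexp]
    push_cast
    rw [mul_mul_mul_comm, hone]
    ring
  rw [setIntegral_ball_eq_polar]
  simp_rw [hpolar]
  rw [Measure.volume_eq_prod, setIntegral_prod_mul
    (fun r : ℝ => ((r ^ (i + j + 1) * (1 - r ^ 2) : ℝ) : ℂ))
    (fun θ : ℝ => Complex.exp (Complex.I * ((i - j : ℤ) : ℂ) * θ))]
  split_ifs with h
  · subst h
    rw [← two_mul, integral_pow_mul_one_sub_sq]
    simp [Real.pi_pos.le]
    field_simp
    norm_num
  · rw [integral_exp_int_mul (by omega), mul_zero]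

/-! ### Divergence of the even moments -/

theorem lintegral_one_sub_inv_eq_top :
    ∫⁻ r in Set.Ioo (1 / 2 : ℝ) 1, ENNReal.ofReal (1 - r)⁻¹ = ⊤ := by
  by_contra h
  have hint : IntegrableOn (fun r : ℝ => (1 - r)⁻¹) (Set.Ioo (1 / 2 : ℝ) 1) := by
    refine (lintegral_ofReal_ne_top_iff_integrable ?_ ?_).1 h
    · exact Measurable.aestronglyMeasurable (by fun_prop)
    · filter_upwards [ae_restrict_mem measurableSet_Ioo] with r hr
      exact inv_nonneg.2 (by linarith [hr.2])
  have h2 : IntervalIntegrable (fun r : ℝ => (r - 1)⁻¹) volume (1 / 2) 1 := by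
    rw [intervalIntegrable_iff_integrableOn_Ioo_of_le (by norm_num)]
    refine hint.neg.congr_fun (fun r _ => ?_) measurableSet_Ioo
    rw [Pi.neg_apply, ← inv_neg, neg_sub]
  rw [intervalIntegrable_sub_inv_iff] at h2
  norm_num at h2

theorem measurable_diskWeight :
    Measurable fun z : ℂ => ENNReal.ofReal (1 / (1 - z.re ^ 2 - z.im ^ 2)) := by
  fun_prop

theorem lintegral_diskMeasure_eq_top (m n : ℕ) :
    ∫⁻ z, ENNReal.ofReal (z.re ^ (2 * m) * z.im ^ (2 * n)) ∂diskMeasure = ⊤ := by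
  rw [diskMeasure, lintegral_withDensity_eq_lintegral_mul _ measurable_diskWeight (by fun_prop),
    ← lintegral_indicator measurableSet_ball, ← Complex.lintegral_comp_polarCoord_symm]
  -- On this sector cos θ, sin θ and r are at least 1/2, so x, y ≥ 1/4. In `c` the two factors 1/2
  -- bound the Jacobian r and (1 + r)⁻¹ from below.
  set S : Set (ℝ × ℝ) := Set.Ioo (1 / 2 : ℝ) 1 ×ˢ Set.Ioo (Real.pi / 6) (Real.pi / 3) with hS
  set c : ℝ := 1 / 2 * (1 / 2 * ((1 / 4) ^ (2 * m) * (1 / 4) ^ (2 * n))) with hc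
  have hc0 : 0 < c := by positivity
  have hpi := Real.pi_pos
  have hsub : S ⊆ polarCoord.target := by
    rintro ⟨r, θ⟩ ⟨⟨hr, _⟩, hθ1, hθ2⟩
    simp only at hr hθ1 hθ2
    refine ⟨?_, ?_, ?_⟩
    · simp only [Set.mem_Ioi]
      linarith
    · simp only
      linarith
    · simp only
      linarith
  have hSm : MeasurableSet S := measurableSet_Ioo.prod measurableSet_Ioo
  have hlow : ∫⁻ x in S, ENNReal.ofReal (1 - x.1)⁻¹ * ENNReal.ofReal c = ⊤ := by
    rw [hS, Measure.volume_eq_prod, ← Measure.prod_restrict,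
      lintegral_prod_mul (f := fun r : ℝ => ENNReal.ofReal (1 - r)⁻¹)
        (g := fun _ : ℝ => ENNReal.ofReal c) (by fun_prop) (by fun_prop),
      lintegral_one_sub_inv_eq_top, ENNReal.top_mul]
    rw [setLIntegral_const, Real.volume_Ioo]
    refine mul_ne_zero (by simpa using hc0) ?_
    simp
    linarith
  refine top_le_iff.1 (hlow.ge.trans ((setLIntegral_mono' hSm ?_).trans
    (lintegral_mono_set hsub)))
  rintro ⟨r, θ⟩ ⟨⟨hr1, hr2⟩, hθ1, hθ2⟩
  simp only at hr1 hr2 hθ1 hθ2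
  have hcos : 1 / 2 ≤ Real.cos θ := by
    rw [← Real.cos_pi_div_three]
    exact Real.cos_le_cos_of_nonneg_of_le_pi (by linarith) (by linarith) hθ2.le
  have hsin : 1 / 2 ≤ Real.sin θ := by
    rw [← Real.sin_pi_div_six]
    exact Real.sin_le_sin_of_le_of_le_pi_div_two (by linarith) (by linarith) hθ1.le
  have hmem : Complex.polarCoord.symm (r, θ) ∈ Metric.ball (0 : ℂ) 1 := by
    rw [mem_ball_zero_iff, Complex.norm_polarCoord_symm, abs_of_pos (by simp; linarith)]
    exact hr2
  have hre : (Complex.polarCoord.symm (r, θ)).re = r * Real.cos θ := by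
    simp [Complex.cos_ofReal_re]
  have him : (Complex.polarCoord.symm (r, θ)).im = r * Real.sin θ := by
    simp [Complex.sin_ofReal_re]
  have hw : 1 - (r * Real.cos θ) ^ 2 - (r * Real.sin θ) ^ 2 = (1 - r) * (1 + r) := by
    linear_combination (-r ^ 2) * Real.sin_sq_add_cos_sq θ
  rw [Set.indicator_of_mem hmem, Pi.mul_apply, hre, him, hw, smul_eq_mul,
    ← ENNReal.ofReal_mul (inv_nonneg.2 (by linarith)), ← ENNReal.ofReal_mul, ← ENNReal.ofReal_mul]
  · refine ENNReal.ofReal_le_ofReal ?_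
    have h1 : 1 / 4 ≤ r * Real.cos θ := by nlinarith
    have h2 : 1 / 4 ≤ r * Real.sin θ := by nlinarith
    have h3 : 1 / 2 ≤ (1 + r)⁻¹ := by
      rw [one_div]
      exact inv_anti₀ (by linarith) (by linarith)
    have hr' : 0 ≤ (1 - r)⁻¹ := inv_nonneg.2 (by linarith)
    calc (1 - r)⁻¹ * c ≤ (1 - r)⁻¹ * (r * ((1 + r)⁻¹ *
          ((r * Real.cos θ) ^ (2 * m) * (r * Real.sin θ) ^ (2 * n)))) := by
          rw [hc]
          gcongr
      _ = _ := by
          rw [one_div, mul_inv]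
          ring
  · linarith
  · exact one_div_nonneg.2 (mul_nonneg (by linarith) (by linarith))

/-! ### The weighted L² space -/

theorem integrableOn_ball_of_continuous {f : ℂ → ℂ} (hf : Continuous f) :
    IntegrableOn f (Metric.ball (0 : ℂ) 1) :=
  (hf.continuousOn.integrableOn_compact (isCompact_closedBall 0 1)).mono_set
    Metric.ball_subset_closedBall

theorem one_sub_mul_star (z : ℂ) : 1 - z * star z = ((1 - z.re ^ 2 - z.im ^ 2 : ℝ) : ℂ) := by
  change 1 - z * (starRingEnd ℂ) z = _
  rw [Complex.mul_conj, Complex.normSq_apply]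
  push_cast
  ring

theorem one_sub_sq_sub_sq_pos {z : ℂ} (hz : z ∈ Metric.ball (0 : ℂ) 1) :
    0 < 1 - z.re ^ 2 - z.im ^ 2 := by
  rw [mem_ball_zero_iff] at hz
  have h := Complex.sq_norm z
  rw [Complex.normSq_apply] at h
  nlinarith [norm_nonneg z]

theorem integral_diskMeasure (f : ℂ → ℂ) :
    ∫ z, f z ∂diskMeasure = ∫ z in Metric.ball (0 : ℂ) 1, (1 - z * star z)⁻¹ * f z := by
  rw [diskMeasure, integral_withDensity_eq_integral_toReal_smul measurable_diskWeight (by simp)]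
  refine setIntegral_congr_fun measurableSet_ball fun z hz => ?_
  have h := one_sub_sq_sub_sq_pos hz
  rw [ENNReal.toReal_ofReal (by positivity), one_sub_mul_star, Complex.real_smul, one_div,
    Complex.ofReal_inv]

theorem continuous_scatteringPoly {p q : ℕ} (hq : 1 ≤ q) : Continuous (scatteringPoly p q) := by
  rw [funext fun z => scatteringPoly_eq_mul_cofactor (p := p) hq z]
  have := continuous_scatteringCofactor p q
  fun_prop

/-- After cancelling the weight, the integrand is (1 - |z|²) times the squared norm of the cofactor,
which is continuous on the closed disk. -/
theorem memLp_scatteringPoly {p q : ℕ} (hq : 1 ≤ q) :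
    MemLp (scatteringPoly p q) 2 diskMeasure := by
  have hc := continuous_scatteringPoly (p := p) hq
  rw [memLp_two_iff_integrable_sq_norm hc.aestronglyMeasurable, diskMeasure,
    integrable_withDensity_iff measurable_diskWeight (by simp)]
  have hc' := continuous_scatteringCofactor p q
  have h : IntegrableOn (fun z : ℂ => (1 - z.re ^ 2 - z.im ^ 2) * ‖scatteringCofactor p q z‖ ^ 2)
      (Metric.ball (0 : ℂ) 1) :=
    ((by fun_prop : Continuous fun z : ℂ => (1 - z.re ^ 2 - z.im ^ 2) *
      ‖scatteringCofactor p q z‖ ^ 2).continuousOn.integrableOn_compact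
      (isCompact_closedBall 0 1)).mono_set Metric.ball_subset_closedBall
  refine h.congr_fun (fun z hz => ?_) measurableSet_ball
  have h := one_sub_sq_sub_sq_pos hz
  simp only
  rw [ENNReal.toReal_ofReal (by positivity), scatteringPoly_eq_mul_cofactor hq, one_sub_mul_star,
    norm_mul, Complex.norm_real, Real.norm_of_nonneg h.le]
  field_simp

/-- The real factor 1 - |z|² of φ alone absorbs the weight, so `f` needs no vanishing at the
boundary. -/
theorem inner_toLp_scatteringPoly {p q : ℕ} (hq : 1 ≤ q)
    (hφ : MemLp (scatteringPoly p q) 2 diskMeasure) {f : ℂ → ℂ} (hf : MemLp f 2 diskMeasure) :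
    inner ℂ (hφ.toLp (scatteringPoly p q)) (hf.toLp f) =
      ∫ z in Metric.ball (0 : ℂ) 1, star (scatteringCofactor p q z) * f z := by
  have h : inner ℂ (hφ.toLp (scatteringPoly p q)) (hf.toLp f) =
      ∫ z, star (scatteringPoly p q z) * f z ∂diskMeasure := by
    rw [L2.inner_def]
    refine integral_congr_ae ?_
    filter_upwards [hφ.coeFn_toLp, hf.coeFn_toLp] with z h1 h2
    rw [h1, h2, RCLike.inner_apply, mul_comm]
    rfl
  rw [h, integral_diskMeasure]
  refine setIntegral_congr_fun measurableSet_ball fun z hz => ?_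
  have h := (one_sub_sq_sub_sq_pos hz).ne'
  have hr : star (1 - z * star z) = 1 - z * star z := by
    simp [mul_comm]
  rw [scatteringPoly_eq_mul_cofactor hq, star_mul', hr, mul_assoc, inv_mul_cancel_left₀]
  rw [one_sub_mul_star]
  exact_mod_cast h

/-! ### Orthogonality -/

theorem star_scatteringCofactor (p q : ℕ) (z : ℂ) :
    star (scatteringCofactor p q z) = ∑ k ∈ Finset.range (p + q),
      (scatteringCoeff p q k : ℂ) * (z ^ (k - q) * star z ^ (k - p)) := by
  rw [scatteringCofactor, star_sum]
  refine Finset.sum_congr rfl fun k _ => ?_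
  rw [star_mul', star_mul', star_pow, star_pow, star_star, mul_comm (star z ^ _)]
  simp

theorem setIntegral_star_scatteringCofactor_mul (p q i j : ℕ) :
    ∫ z in Metric.ball (0 : ℂ) 1,
      star (scatteringCofactor p q z) * ((1 - z * star z) * (z ^ i * star z ^ j)) =
    ∑ k ∈ Finset.range (p + q), (scatteringCoeff p q k : ℂ) *
      if k - q + i = k - p + j then
        ((Real.pi / (((k - q + i : ℕ) + 1) * ((k - q + i : ℕ) + 2)) : ℝ) : ℂ) else 0 := by
  have h (z : ℂ) : star (scatteringCofactor p q z) * ((1 - z * star z) * (z ^ i * star z ^ j)) =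
      ∑ k ∈ Finset.range (p + q), (scatteringCoeff p q k : ℂ) *
        ((1 - z * star z) * (z ^ (k - q + i) * star z ^ (k - p + j))) := by
    rw [star_scatteringCofactor, Finset.sum_mul]
    refine Finset.sum_congr rfl fun k _ => ?_
    ring
  simp_rw [h]
  rw [integral_finsetSum _ fun k _ => integrableOn_ball_of_continuous (by fun_prop)]
  refine Finset.sum_congr rfl fun k _ => ?_
  rw [integral_const_mul, setIntegral_ball_pow_mul_star_pow]

theorem setIntegral_star_scatteringCofactor_mul_eq_zero {p q i j : ℕ}
    (h : i + p ≠ j + q ∨ i + 1 < q) :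
    ∫ z in Metric.ball (0 : ℂ) 1,
      star (scatteringCofactor p q z) * ((1 - z * star z) * (z ^ i * star z ^ j)) = 0 := by
  rw [setIntegral_star_scatteringCofactor_mul]
  by_cases hij : i + p = j + q
  · have hi : i + 1 < q := h.resolve_left (not_not.2 hij)
    -- With this u the radial denominators (k - q + i + 1)(k - q + i + 2) become (k - (u + 1))(k -
    -- u), and i + p = j + q yields u + 1 < p.
    obtain ⟨u, rfl⟩ : ∃ u, q = u + i + 2 := ⟨q - i - 2, by omega⟩
    have hsum := sum_scatteringCoeff_div_eq_zero (p := p) (q := u + i + 2) (u := u)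
      (by omega) (by omega)
    have hsum' : (Real.pi : ℂ) * ((∑ k ∈ Finset.range (p + (u + i + 2)),
      scatteringCoeff p (u + i + 2) k / (((k : ℝ) - u) * ((k : ℝ) - (u + 1 : ℕ))) : ℝ) : ℂ) = 0 := by
      rw [hsum]
      simp
    rw [← hsum', Complex.ofReal_sum, Finset.mul_sum]
    refine Finset.sum_congr rfl fun k _ => ?_
    rcases lt_or_ge k (max p (u + i + 2)) with hk | hk
    · simp [scatteringCoeff_eq_zero hk]
    · rw [max_le_iff] at hk
      rw [if_pos (by omega), (by omega : k - (u + i + 2) + i = k - (u + 2)),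
        Nat.cast_sub (by omega : u + 2 ≤ k)]
      push_cast
      ring
  · refine Finset.sum_eq_zero fun k _ => ?_
    rcases lt_or_ge k (max p q) with hk | hk
    · simp [scatteringCoeff_eq_zero hk]
    · rw [max_le_iff] at hk
      rw [if_neg (by omega), mul_zero]

/-- The monomials in the second cofactor have i - j = q' - p' and i ≤ q' - 1, so each one is
annihilated separately. -/
theorem inner_toLp_scatteringPoly_eq_zero {p q p' q' : ℕ} (hq : 1 ≤ q) (hq' : 1 ≤ q')
    (h : p + q' ≠ p' + q ∨ q' < q) (hφ : MemLp (scatteringPoly p q) 2 diskMeasure)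
    (hφ' : MemLp (scatteringPoly p' q') 2 diskMeasure) :
    inner ℂ (hφ.toLp (scatteringPoly p q)) (hφ'.toLp (scatteringPoly p' q')) = 0 := by
  rw [inner_toLp_scatteringPoly hq hφ hφ']
  have hexp (z : ℂ) : star (scatteringCofactor p q z) * scatteringPoly p' q' z =
      ∑ l ∈ Finset.range (p' + q'), (scatteringCoeff p' q' l : ℂ) *
        (star (scatteringCofactor p q z) *
          ((1 - z * star z) * (z ^ (l - p') * star z ^ (l - q')))) := by
    rw [scatteringPoly_eq_mul_cofactor hq', scatteringCofactor.eq_1 p' q',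
      Finset.mul_sum, Finset.mul_sum]
    refine Finset.sum_congr rfl fun l _ => ?_
    ring
  have hc := continuous_scatteringCofactor p q
  simp_rw [hexp]
  rw [integral_finsetSum _ fun k _ => integrableOn_ball_of_continuous (by fun_prop)]
  refine Finset.sum_eq_zero fun l hl => ?_
  rw [integral_const_mul]
  rcases lt_or_ge l (max p' q') with hl' | hl'
  · simp [scatteringCoeff_eq_zero hl']
  · rw [max_le_iff] at hl'
    have hl := Finset.mem_range.1 hl
    rw [setIntegral_star_scatteringCofactor_mul_eq_zero (by omega), mul_zero]

/-! ### Nonvanishing in L² -/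

/-- The density is at least 1 on the disk. This carries null sets and square integrability over to
Lebesgue measure. -/
theorem volume_restrict_ball_le_diskMeasure :
    volume.restrict (Metric.ball (0 : ℂ) 1) ≤ diskMeasure := by
  rw [diskMeasure]
  conv_lhs => rw [← withDensity_one (μ := volume.restrict (Metric.ball (0 : ℂ) 1))]
  refine withDensity_mono ?_
  filter_upwards [ae_restrict_mem measurableSet_ball] with z hz
  have h := one_sub_sq_sub_sq_pos hz
  rw [Pi.one_apply, ENNReal.one_le_ofReal, one_div]
  exact one_le_inv_iff₀.2 ⟨h, by nlinarith [sq_nonneg z.re, sq_nonneg z.im]⟩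

theorem toLp_scatteringPoly_ne_zero {p q : ℕ} (hp : 1 ≤ p) (hq : 1 ≤ q)
    (hφ : MemLp (scatteringPoly p q) 2 diskMeasure) : hφ.toLp (scatteringPoly p q) ≠ 0 := by
  intro h
  have hae : scatteringPoly p q =ᵐ[diskMeasure] 0 :=
    hφ.coeFn_toLp.symm.trans ((Lp.eq_zero_iff_ae_eq_zero).1 h)
  have hball : Set.EqOn (scatteringPoly p q) 0 (Metric.ball (0 : ℂ) 1) :=
    Measure.eqOn_open_of_ae_eq (ae_mono volume_restrict_ball_le_diskMeasure hae) Metric.isOpen_ball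
      (continuous_scatteringPoly hq).continuousOn continuousOn_const
  have hcof : Set.EqOn (scatteringCofactor p q) 0 (Metric.ball (0 : ℂ) 1) := by
    intro z hz
    have h0 := hball hz
    rw [scatteringPoly_eq_mul_cofactor hq, one_sub_mul_star] at h0
    exact (mul_eq_zero.1 h0).resolve_left (mod_cast (one_sub_sq_sub_sq_pos hz).ne')
  -- Continuity extends the vanishing to the boundary point 1, where the cofactor is known to be
  -- nonzero.
  have hclos := hcof.closure (continuous_scatteringCofactor p q) continuous_const
  rw [closure_ball _ one_ne_zero] at hclos
  exact scatteringCofactor_one_ne_zero hp hq (hclos (by simp))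

/-! ### Density of the span -/

theorem scatteringCoeff_last_ne_zero {p q : ℕ} (hp : 1 ≤ p) (hq : 1 ≤ q) :
    scatteringCoeff p q (p + q - 1) ≠ 0 := by
  have h1 : (p + q - 1).descFactorial q ≠ 0 := by
    rw [Ne, Nat.descFactorial_eq_zero_iff_lt]
    omega
  have h2 : (p + q - 1).descFactorial p ≠ 0 := by
    rw [Ne, Nat.descFactorial_eq_zero_iff_lt]
    omega
  have h3 : q ≠ 0 := by omega
  simp [scatteringCoeff, h1, h2, h3, Nat.factorial_ne_zero]

theorem integrableOn_ball_mul {f G : ℂ → ℂ} (hf : Continuous f)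
    (hG : IntegrableOn G (Metric.ball (0 : ℂ) 1)) :
    IntegrableOn (fun z => f z * G z) (Metric.ball (0 : ℂ) 1) := by
  obtain ⟨C, hC⟩ := (isCompact_closedBall (0 : ℂ) 1).exists_bound_of_continuousOn hf.continuousOn
  refine Integrable.bdd_mul hG hf.aestronglyMeasurable (c := C) ?_
  filter_upwards [ae_restrict_mem measurableSet_ball] with z hz
  exact hC z (Metric.ball_subset_closedBall hz)

/-- A function orthogonal to all cofactors is orthogonal to all monomials, because the leading
term of the cofactor of index `(i + 1, j + 1)` is a multiple of `z ^ j * z̄ ^ i`. -/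
theorem setIntegral_monomial_mul_eq_zero {G : ℂ → ℂ} (hG : IntegrableOn G (Metric.ball (0 : ℂ) 1))
    (h : ∀ p q : ℕ, 1 ≤ p → 1 ≤ q →
      ∫ z in Metric.ball (0 : ℂ) 1, star (scatteringCofactor p q z) * G z = 0) (i j : ℕ) :
    ∫ z in Metric.ball (0 : ℂ) 1, z ^ i * star z ^ j * G z = 0 := by
  -- The non-leading terms of the conjugate cofactor all have a smaller power of z, so induction on
  -- `i` alone suffices once `j` is arbitrary.
  induction i using Nat.strong_induction_on generalizing j with
  | _ i ih =>
    have hij := h (i + 1) (j + 1) (by omega) (by omega)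
    have hexp (z : ℂ) : star (scatteringCofactor (i + 1) (j + 1) z) * G z =
        ∑ k ∈ Finset.range (i + 1 + (j + 1)), (scatteringCoeff (i + 1) (j + 1) k : ℂ) *
          (z ^ (k - (j + 1)) * star z ^ (k - (i + 1)) * G z) := by
      rw [star_scatteringCofactor, Finset.sum_mul]
      refine Finset.sum_congr rfl fun k _ => ?_
      ring
    simp_rw [hexp] at hij
    rw [integral_finsetSum _ fun k _ => (integrableOn_ball_mul (by fun_prop) hG).const_mul _,
      (by omega : i + 1 + (j + 1) = (i + 1 + (j + 1) - 1) + 1), Finset.sum_range_succ,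
      Finset.sum_eq_zero, zero_add, integral_const_mul, mul_eq_zero] at hij
    · have hne : (scatteringCoeff (i + 1) (j + 1) (i + 1 + (j + 1) - 1) : ℂ) ≠ 0 :=
        mod_cast scatteringCoeff_last_ne_zero (by omega) (by omega)
      have := hij.resolve_left hne
      rwa [(by omega : i + 1 + (j + 1) - 1 - (j + 1) = i),
        (by omega : i + 1 + (j + 1) - 1 - (i + 1) = j)] at this
    · intro k hk
      have hk := Finset.mem_range.1 hk
      rw [integral_const_mul]
      rcases lt_or_ge k (max (i + 1) (j + 1)) with hk' | hk'
      · simp [scatteringCoeff_eq_zero hk']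
      · rw [max_le_iff] at hk'
        rw [ih _ (by omega), mul_zero]

/-- By the Stone-Weierstrass theorem, an integrable function on the disk that is orthogonal to all
monomials in `z` and `z̄` is orthogonal to all continuous functions. -/
theorem setIntegral_mul_eq_zero_of_monomial {G : ℂ → ℂ}
    (hG : IntegrableOn G (Metric.ball (0 : ℂ) 1))
    (h : ∀ i j : ℕ, ∫ z in Metric.ball (0 : ℂ) 1, z ^ i * star z ^ j * G z = 0)
    {f : ℂ → ℂ} (hf : Continuous f) :
    ∫ z in Metric.ball (0 : ℂ) 1, f z * G z = 0 := by
  set K := Metric.closedBall (0 : ℂ) 1 with hK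
  have : CompactSpace K := isCompact_iff_compactSpace.1 (isCompact_closedBall 0 1)
  -- The star closure is the linear span of the monomials in z and z̄. The extension `g` to ℂ is
  -- carried along because the integrals involve functions on ℂ, not on `K`.
  have hpoly : ∀ P ∈ (polynomialFunctions K).starClosure, ∃ g : ℂ → ℂ, Continuous g ∧
      (∀ z : K, g z = P z) ∧ ∫ z in Metric.ball (0 : ℂ) 1, g z * G z = 0 := by
    intro P hP
    rw [polynomialFunctions.starClosure_eq_adjoin_X, ← StarSubalgebra.mem_toSubalgebra,
      StarAlgebra.adjoin_toSubalgebra, ← Subalgebra.mem_toSubmodule, Algebra.adjoin_eq_span,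
      Set.star_singleton, Set.singleton_union] at hP
    induction hP using Submodule.span_induction with
    | mem P hP =>
      obtain ⟨i, j, rfl⟩ := (Submonoid.mem_closure_pair _ _ _).1 hP
      exact ⟨fun z => z ^ i * star z ^ j, by fun_prop, fun z => by simp, h i j⟩
    | zero => exact ⟨0, continuous_const, fun z => rfl, by simp⟩
    | add P Q _ _ hP hQ =>
      obtain ⟨g, hg, hgP, hg0⟩ := hP
      obtain ⟨g', hg', hgQ, hg0'⟩ := hQ
      refine ⟨g + g', hg.add hg', fun z => by simp [hgP, hgQ], ?_⟩
      simp only [Pi.add_apply, add_mul]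
      rw [integral_add (integrableOn_ball_mul hg hG) (integrableOn_ball_mul hg' hG), hg0, hg0',
        add_zero]
    | smul c P _ hP =>
      obtain ⟨g, hg, hgP, hg0⟩ := hP
      refine ⟨c • g, hg.const_smul c, fun z => by simp [hgP], ?_⟩
      simp only [Pi.smul_apply, smul_eq_mul, mul_assoc]
      rw [integral_const_mul, hg0, mul_zero]
  have hdense : (⟨fun z : K => f z, by fun_prop⟩ : C(K, ℂ)) ∈
      closure ((polynomialFunctions K).starClosure : Set C(K, ℂ)) := by
    rw [← StarSubalgebra.topologicalClosure_coe,
      polynomialFunctions.starClosure_topologicalClosure]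
    trivial
  set I := ∫ z in Metric.ball (0 : ℂ) 1, ‖G z‖ with hI
  have hI0 : 0 ≤ I := integral_nonneg fun z => norm_nonneg _
  rw [← norm_le_zero_iff]
  refine le_of_forall_pos_le_add fun ε hε => ?_
  -- Dividing by I + 1 rather than I covers the case I = 0.
  obtain ⟨P, hP, hdist⟩ := Metric.mem_closure_iff.1 hdense (ε / (I + 1)) (by positivity)
  obtain ⟨g, hg, hgP, hg0⟩ := hpoly P hP
  have hbound : ∀ z ∈ Metric.ball (0 : ℂ) 1, ‖f z - g z‖ ≤ ε / (I + 1) := by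
    intro z hz
    have hz' : z ∈ K := Metric.ball_subset_closedBall hz
    have := (ContinuousMap.dist_apply_le_dist (f := (⟨fun z : K => f z, by fun_prop⟩ : C(K, ℂ)))
      (g := P) ⟨z, hz'⟩).trans hdist.le
    rw [← hgP ⟨z, hz'⟩, dist_eq_norm] at this
    exact this
  have heq : ∫ z in Metric.ball (0 : ℂ) 1, f z * G z =
      ∫ z in Metric.ball (0 : ℂ) 1, (f z - g z) * G z := by
    simp only [sub_mul]
    rw [integral_sub (integrableOn_ball_mul hf hG) (integrableOn_ball_mul hg hG), hg0, sub_zero]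
  rw [heq, zero_add]
  calc ‖∫ z in Metric.ball (0 : ℂ) 1, (f z - g z) * G z‖
      ≤ ∫ z in Metric.ball (0 : ℂ) 1, ε / (I + 1) * ‖G z‖ := by
        refine norm_integral_le_of_norm_le (hG.norm.const_mul _) ?_
        filter_upwards [ae_restrict_mem measurableSet_ball] with z hz
        rw [norm_mul]
        exact mul_le_mul_of_nonneg_right (hbound z hz) (norm_nonneg _)
    _ = ε / (I + 1) * I := by rw [integral_const_mul]
    _ ≤ ε := by
        rw [div_mul_eq_mul_div, div_le_iff₀ (by positivity)]
        nlinarith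

theorem topologicalClosure_span_scatteringPoly
    (hL2 : ∀ i : ℕ+ × ℕ+, MemLp (scatteringPoly i.1 i.2) 2 diskMeasure) :
    (Submodule.span ℂ (Set.range fun i : ℕ+ × ℕ+ =>
      (hL2 i).toLp (scatteringPoly i.1 i.2))).topologicalClosure = ⊤ := by
  rw [Submodule.topologicalClosure_eq_top_iff, Submodule.eq_bot_iff]
  intro G hG
  have hmem := Lp.memLp G
  have hint : IntegrableOn G (Metric.ball (0 : ℂ) 1) := by
    have : IsFiniteMeasure (volume.restrict (Metric.ball (0 : ℂ) 1)) :=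
      ⟨by simp⟩
    exact (hmem.mono_measure volume_restrict_ball_le_diskMeasure).integrable one_le_two
  have horth (p q : ℕ) (hp : 1 ≤ p) (hq : 1 ≤ q) :
      ∫ z in Metric.ball (0 : ℂ) 1, star (scatteringCofactor p q z) * G z = 0 := by
    have h := (Submodule.mem_orthogonal _ _).1 hG _
      (Submodule.subset_span ⟨(⟨p, hp⟩, ⟨q, hq⟩), rfl⟩)
    rw [← Lp.toLp_coeFn G hmem] at h
    rwa [← inner_toLp_scatteringPoly hq (memLp_scatteringPoly hq) hmem]
  have hzero : ∀ᵐ z ∂(volume.restrict (Metric.ball (0 : ℂ) 1)), G z = 0 := by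
    refine ae_eq_zero_of_integral_contDiff_smul_eq_zero hint.locallyIntegrable fun g hg _ => ?_
    have hgc := hg.continuous
    simp only [Complex.real_smul]
    exact setIntegral_mul_eq_zero_of_monomial hint (setIntegral_monomial_mul_eq_zero hint horth)
      (f := fun z => (g z : ℂ)) (by fun_prop)
  rw [Lp.eq_zero_iff_ae_eq_zero]
  exact (withDensity_absolutelyContinuous _ _).ae_le hzero

theorem isOrthogonalBasis_scatteringPoly
    (hL2 : ∀ i : ℕ+ × ℕ+, MemLp (scatteringPoly i.1 i.2) 2 diskMeasure) :
    IsOrthogonalBasis (H := Lp ℂ 2 diskMeasure)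
      fun i : ℕ+ × ℕ+ => (hL2 i).toLp (scatteringPoly i.1 i.2) where
  ne_zero i := toLp_scatteringPoly_ne_zero i.1.pos i.2.pos (hL2 i)
  orthogonal := by
    rintro ⟨p, q⟩ ⟨p', q'⟩ hne
    have hne' : ¬((p : ℕ) = p' ∧ (q : ℕ) = q') := fun h =>
      hne (Prod.ext (PNat.coe_injective h.1) (PNat.coe_injective h.2))
    by_cases h : (p : ℕ) + q' ≠ p' + q ∨ (q' : ℕ) < q
    · exact inner_toLp_scatteringPoly_eq_zero q.pos q'.pos h _ _
    -- What remains is p - q = p' - q' with q < q', the previous case with the roles exchanged.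
    · rw [inner_eq_zero_symm]
      exact inner_toLp_scatteringPoly_eq_zero q'.pos q.pos (by omega) _ _
  dense_span := topologicalClosure_span_scatteringPoly hL2

theorem theorem1 :
    -- the scattering polynomials are polynomials in `x` and `y`
    (∀ p q : ℕ, 1 ≤ p → 1 ≤ q → ∃ P : MvPolynomial (Fin 2) ℂ, ∀ z : ℂ,
      scatteringPoly p q z = MvPolynomial.eval ![(z.re : ℂ), (z.im : ℂ)] P) ∧
    -- they form an orthogonal basis of the weighted `L²` space
    (∃ hL2 : ∀ i : ℕ+ × ℕ+, MeasureTheory.MemLp (scatteringPoly i.1 i.2) 2 diskMeasure,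
      IsOrthogonalBasis (H := MeasureTheory.Lp ℂ 2 diskMeasure)
        fun i : ℕ+ × ℕ+ => (hL2 i).toLp (scatteringPoly i.1 i.2)) ∧
    -- all even moments of the measure are infinite
    (∀ m n : ℕ, ∫⁻ z, ENNReal.ofReal (z.re ^ (2 * m) * z.im ^ (2 * n)) ∂diskMeasure = ⊤) ∧
    -- they are eigenfunctions of `-(1 - |z|²) Δ / 4`
    (∀ p q : ℕ, 1 ≤ p → 1 ≤ q → ∀ z : ℂ,
      -((1 - (‖z‖ : ℂ) ^ 2) / 4 * Laplacian.laplacian (scatteringPoly p q) z) =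
        (p : ℂ) * (q : ℂ) * scatteringPoly p q z) ∧
    -- they are represented by Jacobi polynomials in polar coordinates
    (∀ p q : ℕ, 1 ≤ p → 1 ≤ q → ∀ r θ : ℝ,
      scatteringPoly p q ((r : ℂ) * Complex.exp (Complex.I * θ)) =
        (-1) ^ (q + 1) * (max p q : ℕ) / (q : ℂ) *
          (((1 - r ^ 2) * r ^ ((p : ℤ) - (q : ℤ)).natAbs *
            jacobiP 1 ((p : ℤ) - (q : ℤ)).natAbs (min p q - 1) (2 * r ^ 2 - 1) : ℝ) : ℂ) *
          Complex.exp (Complex.I * ((q : ℂ) - (p : ℂ)) * θ)) := by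
  refine ⟨fun p q _ hq => exists_mvPolynomial_eq_scatteringPoly hq,
    ⟨fun i => memLp_scatteringPoly i.2.pos, isOrthogonalBasis_scatteringPoly _⟩,
    lintegral_diskMeasure_eq_top,
    fun p q _ hq z => neg_mul_laplacian_scatteringPoly hq z,
    fun p q hp hq r θ => scatteringPoly_polar hp hq r θ⟩
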